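/- Call an equivalence relation $\rho$ on a semigroup $S$ a right congruence if $a\,\rho\,b$ implies $as\,\rho\,bs$ for all $a,b,s\in S$, and call $S$ right noetherian if every right congruence $\rho$ on $S$ is finitely generated, that is, $\rho$ is the smallest right congruence containing some finite subset of $S\times S$. Then the following hold. 1. If $S$ is a right noetherian semigroup and $T$ is a subsemigroup of $S$ that is an inverse semigroup (for each $t\in T$ there is exactly one $x\in T$ with $txt=t$ and $xtx=x$), then $T$ is right noetherian. 2. If $S$ is a right noetherian semigroup and $Y$ is a subsemigroup of $S$ that is a semilattice (a commutative semigroup all of whose elements are idempotent), then $Y$ is finite. 3. If $M$ is a monoid that is right noetherian as a semigroup, and $x\in M$ satisfies $xy=1$ or $yx=1$ for some $y\in M$, then $x$ is a (two-sided) unit of $M$. -/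

import Mathlib

/-- A right congruence on a semigroup: an equivalence relation compatible with right
multiplication. -/
structure RightCongruence (S : Type*) [Semigroup S] extends Setoid S where
  mul_right : ∀ {a b : S}, r a b → ∀ s : S, r (a * s) (b * s)

/-- `ρ` is the right congruence generated by `X`, i.e. the smallest one that contains `X`. -/
def RightCongruence.IsGeneratedBy {S : Type*} [Semigroup S] (ρ : RightCongruence S)
    (X : Set (S × S)) : Prop :=
  (∀ p ∈ X, ρ.r p.1 p.2) ∧
    ∀ σ : RightCongruence S, (∀ p ∈ X, σ.r p.1 p.2) → ∀ a b : S, ρ.r a b → σ.r a b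

/-- A right congruence is finitely generated if some finite set of pairs generates it. -/
def RightCongruence.FinitelyGenerated {S : Type*} [Semigroup S] (ρ : RightCongruence S) : Prop :=
  ∃ X : Set (S × S), X.Finite ∧ ρ.IsGeneratedBy X

/-- A semigroup is right noetherian if every right congruence on it is finitely generated. -/
def RightNoetherianSemigroup (S : Type*) [Semigroup S] : Prop :=
  ∀ ρ : RightCongruence S, ρ.FinitelyGenerated

/-- An inverse semigroup: each element `s` has exactly one inverse, i.e. one element `x` with
`s x s = s` and `x s x = x`. -/
def InverseSemigroup (S : Type*) [Semigroup S] : Prop :=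
  ∀ s : S, ∃! x : S, s * x * s = s ∧ x * s * x = x

/-- A semilattice, as a semigroup: a commutative semigroup of idempotents. -/
def SemilatticeSemigroup (S : Type*) [Semigroup S] : Prop :=
  (∀ a b : S, a * b = b * a) ∧ ∀ a : S, a * a = a

/-! Noetherianity enters through `exists_largest`, the ascending chain condition for directed
families. For inverse T, every right congruence ρ on T is the restriction of one on S, so finite
generation descends (`of_extension`). The extension relates x and y when some w in T turns each
relation h x s = t in T, with h idempotent, into (w h w⁻¹) y s = u with t ρ u, and w⁻¹ does the same
from y to x. Products of the w give transitivity, and quantifying over s gives right compatibility.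
A semilattice is inverse, hence itself right noetherian. Were it infinite, a maximal congruence of
infinite index would exist; each element is an identity or a zero modulo it, leaving at most two
classes. For one-sided inverses, the kernels of left multiplication by xⁿ stabilise. -/

namespace RightCongruence

variable {S : Type*} [Semigroup S]

/-- The right congruence generated by a set of pairs. -/
def generate (X : Set (S × S)) : RightCongruence S where
  r a b := ∀ σ : RightCongruence S, (∀ p ∈ X, σ.r p.1 p.2) → σ.r a b
  iseqv :=
    { refl := fun a σ _ => σ.iseqv.refl a
      symm := fun h σ hσ => σ.iseqv.symm (h σ hσ)
      trans := fun h k σ hσ => σ.iseqv.trans (h σ hσ) (k σ hσ) }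
  mul_right h s σ hσ := σ.mul_right (h σ hσ) s

/-- The preimage of a right congruence under a homomorphism. -/
def comap {Q : Type*} [Semigroup Q] (f : S →ₙ* Q) (σ : RightCongruence Q) :
    RightCongruence S where
  r a b := σ.r (f a) (f b)
  iseqv :=
    { refl := fun a => σ.iseqv.refl (f a)
      symm := fun h => σ.iseqv.symm h
      trans := fun h k => σ.iseqv.trans h k }
  mul_right h s := by
    rw [map_mul, map_mul]
    exact σ.mul_right h (f s)

/-- The union of a nonempty directed family of right congruences. -/
def directedUnion {ι : Type*} [Nonempty ι] (f : ι → RightCongruence S)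
    (hf : ∀ i j, ∃ k, (∀ a b, (f i).r a b → (f k).r a b) ∧ ∀ a b, (f j).r a b → (f k).r a b) :
    RightCongruence S where
  r a b := ∃ i, (f i).r a b
  iseqv :=
    { refl := fun a => ⟨Classical.arbitrary ι, (f _).iseqv.refl a⟩
      symm := fun ⟨i, h⟩ => ⟨i, (f i).iseqv.symm h⟩
      trans := fun ⟨i, h⟩ ⟨j, h'⟩ =>
        let ⟨k, hi, hj⟩ := hf i j
        ⟨k, (f k).iseqv.trans (hi _ _ h) (hj _ _ h')⟩ }
  mul_right := fun ⟨i, h⟩ s => ⟨i, (f i).mul_right h s⟩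

end RightCongruence

/-- In a right noetherian semigroup every nonempty directed family of right congruences has a
largest member. -/
theorem RightNoetherianSemigroup.exists_largest {S : Type*} [Semigroup S]
    (hS : RightNoetherianSemigroup S) {ι : Type*} [Nonempty ι] (f : ι → RightCongruence S)
    (hf : ∀ i j, ∃ k, (∀ a b, (f i).r a b → (f k).r a b) ∧ ∀ a b, (f j).r a b → (f k).r a b) :
    ∃ i, ∀ j a b, (f j).r a b → (f i).r a b := by
  obtain ⟨X, hX, hmem, hmin⟩ := hS (RightCongruence.directedUnion f hf)
  have key : ∃ i, ∀ p ∈ X, (f i).r p.1 p.2 := by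
    clear hmin
    induction X, hX using Set.Finite.induction_on with
    | empty => exact ⟨Classical.arbitrary ι, by simp⟩
    | @insert q X _ _ ih =>
      obtain ⟨i, hi⟩ := ih fun p hp => hmem p (Set.mem_insert_of_mem _ hp)
      obtain ⟨j, hj⟩ := hmem q (Set.mem_insert _ _)
      obtain ⟨k, hik, hjk⟩ := hf i j
      refine ⟨k, fun p hp => ?_⟩
      rcases hp with rfl | hp
      · exact hjk _ _ hj
      · exact hik _ _ (hi p hp)
  obtain ⟨i, hi⟩ := key
  exact ⟨i, fun j a b h => hmin (f i) hi a b ⟨j, h⟩⟩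

/-- A subsemigroup with the right congruence extension property in a right noetherian semigroup
is right noetherian. -/
theorem RightNoetherianSemigroup.of_extension {S T : Type*} [Semigroup S] [Semigroup T]
    (hS : RightNoetherianSemigroup S) (f : T →ₙ* S)
    (ext : ∀ ρ : RightCongruence T, ∃ σ : RightCongruence S, ∀ a b, σ.r (f a) (f b) ↔ ρ.r a b) :
    RightNoetherianSemigroup T := by
  classical
  intro ρ
  let g : Finset {p : T × T // ρ.r p.1 p.2} → RightCongruence S := fun F =>
    RightCongruence.generate {q | ∃ p ∈ F, q = (f p.1.1, f p.1.2)}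
  have mono : ∀ F G, F ⊆ G → ∀ a b, (g F).r a b → (g G).r a b := by
    intro F G hFG a b h σ hσ
    refine h σ ?_
    rintro q ⟨p, hp, rfl⟩
    exact hσ _ ⟨p, hFG hp, rfl⟩
  obtain ⟨F, hF⟩ := hS.exists_largest g fun F G =>
    ⟨F ∪ G, mono _ _ Finset.subset_union_left, mono _ _ Finset.subset_union_right⟩
  refine ⟨Subtype.val '' (F : Set {p : T × T // ρ.r p.1 p.2}), F.finite_toSet.image _, ?_, ?_⟩
  · rintro _ ⟨p, _, rfl⟩
    exact p.2
  · intro τ hτ a b hab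
    -- An extension of τ contains the images of the pairs in `F`, hence the largest congruence `g
    -- F`, hence the image of (a, b).
    obtain ⟨σ, hσ⟩ := ext τ
    rw [← hσ]
    refine hF {⟨(a, b), hab⟩} (f a) (f b) ?_ σ ?_
    · exact fun σ' hσ' => hσ' (f a, f b) ⟨⟨(a, b), hab⟩, by simp, rfl⟩
    · rintro _ ⟨p, hp, rfl⟩
      exact (hσ _ _).2 (hτ _ ⟨p, hp, rfl⟩)

/-! ### Inverse semigroups: idempotents and inverses -/

namespace InverseSemigroup

/-- The inverse of an element of an inverse semigroup. -/
noncomputable def inv {T : Type*} [Semigroup T] (hT : InverseSemigroup T) (t : T) : T :=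
  (hT t).choose

variable {T : Type*} [Semigroup T]

theorem mul_inv_mul (hT : InverseSemigroup T) (t : T) : t * hT.inv t * t = t :=
  (hT t).choose_spec.1.1

theorem inv_mul_inv (hT : InverseSemigroup T) (t : T) : hT.inv t * t * hT.inv t = hT.inv t :=
  (hT t).choose_spec.1.2

theorem eq_inv (hT : InverseSemigroup T) {t x : T} (h₁ : t * x * t = t) (h₂ : x * t * x = x) :
    x = hT.inv t :=
  (hT t).choose_spec.2 x ⟨h₁, h₂⟩

theorem inv_inv (hT : InverseSemigroup T) (t : T) : hT.inv (hT.inv t) = t :=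
  (hT.eq_inv (hT.inv_mul_inv t) (hT.mul_inv_mul t)).symm

theorem inv_of_idem (hT : InverseSemigroup T) {e : T} (he : e * e = e) : hT.inv e = e :=
  (hT.eq_inv (by rw [he, he]) (by rw [he, he])).symm

/-- If x is the inverse of ef, then fxe is another one, so fxe = x. This makes x idempotent, hence
its own inverse, so ef = x. -/
theorem idem_mul (hT : InverseSemigroup T) {e f : T} (he : e * e = e) (hf : f * f = f) :
    e * f * (e * f) = e * f := by
  have he' : ∀ z, e * (e * z) = e * z := fun z => by rw [← mul_assoc, he]
  have hf' : ∀ z, f * (f * z) = f * z := fun z => by rw [← mul_assoc, hf]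
  have h₁ := hT.mul_inv_mul (e * f)
  have h₂ := hT.inv_mul_inv (e * f)
  generalize hx : hT.inv (e * f) = x at h₁ h₂
  have h₂' : ∀ z, x * (e * (f * (x * z))) = x * z := fun z => by
    simpa only [mul_assoc] using congrArg (· * z) h₂
  simp only [mul_assoc] at h₁ h₂
  have hy : f * (x * e) = x := by
    rw [← hx]
    refine hT.eq_inv ?_ ?_
    · simp only [mul_assoc, he', hf', hx, h₁]
    · simp only [mul_assoc, he', hf', hx, h₂']
  have hxx : x * x = x := by
    rw [← hy]
    simp only [mul_assoc, h₂']
  have : e * f = x := by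
    rw [← hT.inv_of_idem hxx, ← hx, hT.inv_inv]
  rw [this, hxx]

/-- Since ef and fe are idempotent, ef is an inverse of fe, which is its own inverse. -/
theorem idem_comm (hT : InverseSemigroup T) {e f : T} (he : e * e = e) (hf : f * f = f) :
    e * f = f * e := by
  have he' : ∀ z, e * (e * z) = e * z := fun z => by rw [← mul_assoc, he]
  have hf' : ∀ z, f * (f * z) = f * z := fun z => by rw [← mul_assoc, hf]
  have h₁ := hT.idem_mul he hf
  have h₂ := hT.idem_mul hf he
  rw [← hT.inv_of_idem h₂]
  refine hT.eq_inv ?_ ?_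
  · simpa only [mul_assoc, he', hf'] using h₂
  · simpa only [mul_assoc, he', hf'] using h₁

theorem inv_mul_idem (hT : InverseSemigroup T) (t : T) :
    hT.inv t * t * (hT.inv t * t) = hT.inv t * t := by
  rw [← mul_assoc, hT.inv_mul_inv]

theorem mul_inv_idem (hT : InverseSemigroup T) (t : T) :
    t * hT.inv t * (t * hT.inv t) = t * hT.inv t := by
  rw [← mul_assoc, hT.mul_inv_mul]

theorem mul_inv_rev (hT : InverseSemigroup T) (a b : T) :
    hT.inv (a * b) = hT.inv b * hT.inv a := by
  have hc := hT.idem_comm (hT.inv_mul_idem a) (hT.mul_inv_idem b)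
  symm
  refine hT.eq_inv ?_ ?_
  · calc a * b * (hT.inv b * hT.inv a) * (a * b)
        = a * (b * hT.inv b * (hT.inv a * a)) * b := by simp only [mul_assoc]
      _ = a * hT.inv a * a * (b * hT.inv b * b) := by rw [← hc]; simp only [mul_assoc]
      _ = a * b := by rw [hT.mul_inv_mul, hT.mul_inv_mul]
  · calc hT.inv b * hT.inv a * (a * b) * (hT.inv b * hT.inv a)
        = hT.inv b * (hT.inv a * a * (b * hT.inv b)) * hT.inv a := by simp only [mul_assoc]
      _ = hT.inv b * b * hT.inv b * (hT.inv a * a * hT.inv a) := by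
          rw [hc]; simp only [mul_assoc]
      _ = hT.inv b * hT.inv a := by rw [hT.inv_mul_inv, hT.inv_mul_inv]

theorem conj_idem (hT : InverseSemigroup T) (w : T) {h : T} (hh : h * h = h) :
    w * h * hT.inv w * (w * h * hT.inv w) = w * h * hT.inv w := by
  calc w * h * hT.inv w * (w * h * hT.inv w)
      = w * (h * (hT.inv w * w)) * h * hT.inv w := by simp only [mul_assoc]
    _ = w * hT.inv w * w * (h * h) * hT.inv w := by
        rw [hT.idem_comm hh (hT.inv_mul_idem w)]; simp only [mul_assoc]
    _ = w * h * hT.inv w := by rw [hT.mul_inv_mul, hh]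

theorem conj_inv_idem (hT : InverseSemigroup T) (w : T) {h : T} (hh : h * h = h) :
    hT.inv w * h * w * (hT.inv w * h * w) = hT.inv w * h * w := by
  simpa only [hT.inv_inv] using hT.conj_idem (hT.inv w) hh

/-! ### Extending right congruences from an inverse subsemigroup -/

variable {Q : Type*} [Monoid Q]

/-- Conjugation by `w` carries every relation `h x s ∈ T`, `h` idempotent, to one for `y`,
inside a `ρ`-class. -/
def Transports (hT : InverseSemigroup T) (ι : T →ₙ* Q) (ρ : RightCongruence T) (w : T)
    (x y : Q) : Prop :=
  ∀ (s : Q) (h t : T), h * h = h → ι h * x * s = ι t →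
    ∃ u, ι (w * h * hT.inv w) * y * s = ι u ∧ ρ.r t u

theorem Transports.trans {hT : InverseSemigroup T} {ι : T →ₙ* Q} {ρ : RightCongruence T}
    {v w : T} {x y z : Q} (hv : hT.Transports ι ρ v x y) (hw : hT.Transports ι ρ w y z) :
    hT.Transports ι ρ (w * v) x z := by
  intro s h t hh e
  obtain ⟨u, hu, htu⟩ := hv s h t hh e
  obtain ⟨u', hu', huu⟩ := hw s _ u (hT.conj_idem v hh) hu
  refine ⟨u', ?_, ρ.iseqv.trans htu huu⟩
  rw [← hu', hT.mul_inv_rev]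
  simp only [mul_assoc]

theorem Transports.mul_right {hT : InverseSemigroup T} {ι : T →ₙ* Q} {ρ : RightCongruence T}
    {w : T} {x y : Q} (h : hT.Transports ι ρ w x y) (q : Q) :
    hT.Transports ι ρ w (x * q) (y * q) := by
  intro s k t hk e
  simpa only [mul_assoc] using h (q * s) k t hk (by simpa only [mul_assoc] using e)

/-- If hps = t then t = p(p⁻¹t), since h commutes with pp⁻¹; hence t ρ q(p⁻¹t), and the latter is
the transported product. -/
theorem transports_of_rel (hT : InverseSemigroup T) {ι : T →ₙ* Q}
    (hι : Function.Injective ι) {ρ : RightCongruence T} {p q : T} (hpq : ρ.r p q) :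
    hT.Transports ι ρ (q * hT.inv p) (ι p) (ι q) := by
  intro s h t hh e
  have ht : p * (hT.inv p * t) = t := by
    apply hι
    rw [← mul_assoc, map_mul ι _ t, ← e, ← mul_assoc, ← map_mul, ← map_mul]
    congr 2
    rw [← mul_assoc, hT.idem_comm (hT.mul_inv_idem p) hh, mul_assoc, hT.mul_inv_mul]
  refine ⟨q * (hT.inv p * t), ?_, ?_⟩
  · rw [← mul_assoc, map_mul ι _ t, ← e, ← mul_assoc, ← mul_assoc, ← map_mul, ← map_mul,
      ← map_mul]
    congr 2
    rw [hT.mul_inv_rev, hT.inv_inv]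
    calc q * hT.inv p * h * (p * hT.inv q) * q
        = q * (hT.inv p * h * p * (hT.inv q * q)) := by simp only [mul_assoc]
      _ = q * hT.inv q * q * (hT.inv p * h * p) := by
          rw [hT.idem_comm (hT.conj_inv_idem p hh) (hT.inv_mul_idem q)]
          simp only [mul_assoc]
      _ = q * hT.inv p * h * p := by rw [hT.mul_inv_mul]; simp only [mul_assoc]
  · have := ρ.mul_right hpq (hT.inv p * t)
    rwa [ht] at this

/-- The extension of a right congruence on an inverse subsemigroup to the whole monoid. -/
def extend (hT : InverseSemigroup T) (ι : T →ₙ* Q) (ρ : RightCongruence T) :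
    RightCongruence Q where
  -- Equality is added for reflexivity: T may have no identity to serve as w.
  r x y := x = y ∨ ∃ w, hT.Transports ι ρ w x y ∧ hT.Transports ι ρ (hT.inv w) y x
  iseqv :=
    { refl := fun _ => Or.inl rfl
      symm := by
        rintro x y (rfl | ⟨w, h, h'⟩)
        · exact Or.inl rfl
        · exact Or.inr ⟨hT.inv w, h', by rwa [hT.inv_inv]⟩
      trans := by
        rintro x y z (rfl | ⟨v, h, h'⟩) (rfl | ⟨w, k, k'⟩)
        · exact Or.inl rfl
        · exact Or.inr ⟨w, k, k'⟩
        · exact Or.inr ⟨v, h, h'⟩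
        · exact Or.inr ⟨w * v, h.trans k, by rw [hT.mul_inv_rev]; exact k'.trans h'⟩ }
  mul_right := by
    rintro x y (rfl | ⟨w, h, h'⟩) q
    · exact Or.inl rfl
    · exact Or.inr ⟨w, h.mul_right q, h'.mul_right q⟩

/-- Start from (aa⁻¹)a = a with s = 1, and transport by w and back by w⁻¹. -/
theorem rel_inv_mul_of_transports (hT : InverseSemigroup T) {ι : T →ₙ* Q}
    (hι : Function.Injective ι) {ρ : RightCongruence T} {w a b : T}
    (h : hT.Transports ι ρ w (ι a) (ι b)) (h' : hT.Transports ι ρ (hT.inv w) (ι b) (ι a)) :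
    ρ.r a (hT.inv w * w * a) := by
  have ha := hT.mul_inv_idem a
  obtain ⟨u, hu, hau⟩ := h 1 (a * hT.inv a) a ha (by rw [mul_one, ← map_mul, hT.mul_inv_mul])
  obtain ⟨v, hv, huv⟩ := h' 1 _ u (hT.conj_idem w ha) hu
  have : v = hT.inv w * w * a := by
    apply hι
    rw [← hv, hT.inv_inv, mul_one, ← map_mul]
    congr 1
    calc hT.inv w * (w * (a * hT.inv a) * hT.inv w) * w * a
        = hT.inv w * w * ((a * hT.inv a) * (hT.inv w * w)) * a := by simp only [mul_assoc]
      _ = hT.inv w * w * hT.inv w * w * (a * hT.inv a * a) := by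
          rw [hT.idem_comm ha (hT.inv_mul_idem w)]; simp only [mul_assoc]
      _ = hT.inv w * w * a := by rw [hT.inv_mul_inv, hT.mul_inv_mul]
  rw [← this]
  exact ρ.iseqv.trans hau huv

theorem extend_rel_iff (hT : InverseSemigroup T) {ι : T →ₙ* Q} (hι : Function.Injective ι)
    (ρ : RightCongruence T) (a b : T) : (hT.extend ι ρ).r (ι a) (ι b) ↔ ρ.r a b := by
  constructor
  · rintro (h | ⟨w, h, h'⟩)
    · rw [hι h]
    · have h₁ := hT.rel_inv_mul_of_transports hι h h'
      have h₂ := hT.rel_inv_mul_of_transports hι h' (by rwa [hT.inv_inv])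
      rw [hT.inv_inv] at h₂
      -- Conjugation by w takes w⁻¹w to ww⁻¹, which links w⁻¹wa to ww⁻¹b.
      obtain ⟨u, hu, hau⟩ := h 1 (hT.inv w * w) (hT.inv w * w * a) (hT.inv_mul_idem w)
        (by rw [mul_one, ← map_mul])
      have : u = w * hT.inv w * b := by
        apply hι
        rw [← hu, mul_one, ← map_mul, ← mul_assoc, hT.mul_inv_mul]
      rw [this] at hau
      exact ρ.iseqv.trans h₁ (ρ.iseqv.trans hau (ρ.iseqv.symm h₂))
  · intro h
    refine Or.inr ⟨b * hT.inv a, hT.transports_of_rel hι h, ?_⟩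
    rw [hT.mul_inv_rev, hT.inv_inv]
    exact hT.transports_of_rel hι (ρ.iseqv.symm h)

end InverseSemigroup

theorem RightNoetherianSemigroup.of_inverse_subsemigroup {S : Type*} [Semigroup S]
    (hS : RightNoetherianSemigroup S) (T : Subsemigroup S) (hT : InverseSemigroup T) :
    RightNoetherianSemigroup T := by
  -- The adjoined identity makes s = 1 available.
  let c : S →ₙ* WithOne S := WithOne.coeMulHom
  refine hS.of_extension (MulMemClass.subtype T) fun ρ =>
    ⟨(hT.extend (c.comp (MulMemClass.subtype T)) ρ).comap c, fun a b => ?_⟩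
  exact hT.extend_rel_iff (ι := c.comp (MulMemClass.subtype T))
    (WithOne.coe_injective.comp Subtype.val_injective) ρ a b

/-! ### Finiteness of semilattices -/

namespace SemilatticeSemigroup

variable {Y : Type*} [Semigroup Y]

theorem inverseSemigroup (hY : SemilatticeSemigroup Y) : InverseSemigroup Y := by
  obtain ⟨hc, hi⟩ := hY
  refine fun s => ⟨s, ⟨by rw [hi, hi], by rw [hi, hi]⟩, ?_⟩
  rintro x ⟨h₁, h₂⟩
  have hs : s * x = s := by rw [← h₁, hc (s * x) s, ← mul_assoc, hi, mul_assoc, hi]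
  have hx : s * x = x := by rw [← h₂, hc x s, mul_assoc, hi, ← mul_assoc, hi]
  rw [← hx, hs]

theorem mul_left (hY : SemilatticeSemigroup Y) (ρ : RightCongruence Y) {a b : Y}
    (h : ρ.r a b) (e : Y) : ρ.r (e * a) (e * b) := by
  rw [hY.1 e a, hY.1 e b]
  exact ρ.mul_right h e

/-- The kernel, modulo `ρ`, of multiplication by `e`. -/
def mulKer (ρ : RightCongruence Y) (e : Y) :
    RightCongruence Y where
  r a b := ρ.r (e * a) (e * b)
  iseqv :=
    { refl := fun a => ρ.iseqv.refl (e * a)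
      symm := fun h => ρ.iseqv.symm h
      trans := fun h k => ρ.iseqv.trans h k }
  mul_right h s := by
    rw [← mul_assoc, ← mul_assoc]
    exact ρ.mul_right h s

/-- The Rees congruence, modulo `ρ`, of the principal ideal of `e`. -/
def rees (hY : SemilatticeSemigroup Y) (ρ : RightCongruence Y) (e : Y) : RightCongruence Y where
  r a b := ρ.r a b ∨ (ρ.r (e * a) a ∧ ρ.r (e * b) b)
  iseqv :=
    { refl := fun a => Or.inl (ρ.iseqv.refl a)
      symm := fun h => h.imp (fun h => ρ.iseqv.symm h) And.symm
      trans := by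
        rintro a b c (h | ⟨h, k⟩) (h' | ⟨h', k'⟩)
        · exact Or.inl (ρ.iseqv.trans h h')
        · exact Or.inr ⟨ρ.iseqv.trans (hY.mul_left ρ h e)
            (ρ.iseqv.trans h' (ρ.iseqv.symm h)), k'⟩
        · exact Or.inr ⟨h, ρ.iseqv.trans (hY.mul_left ρ (ρ.iseqv.symm h') e)
            (ρ.iseqv.trans k h')⟩
        · exact Or.inr ⟨h, k'⟩ }
  mul_right := by
    rintro a b (h | ⟨h, k⟩) s
    · exact Or.inl (ρ.mul_right h s)
    · refine Or.inr ⟨?_, ?_⟩ <;> rw [← mul_assoc]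
      · exact ρ.mul_right h s
      · exact ρ.mul_right k s

/-- A congruence of infinite index above which every other has finite index has every element as
an identity or a zero of its quotient, which is impossible. -/
theorem finite_quotient_of_maximal (hY : SemilatticeSemigroup Y) (ρ : RightCongruence Y)
    (hρ : ∀ σ : RightCongruence Y, (∀ a b, ρ.r a b → σ.r a b) →
      (∀ a b, σ.r a b → ρ.r a b) ∨ Finite (Quotient σ.toSetoid)) :
    Finite (Quotient ρ.toSetoid) := by
  have hi : ∀ e a : Y, e * (e * a) = e * a := fun e a => by rw [← mul_assoc, hY.2]
  by_contra hinf
  have cases_on : ∀ e, (∀ a, ρ.r (e * a) a) ∨ ∀ a, ρ.r (e * a) e := by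
    intro e
    rcases hρ (mulKer ρ e) fun a b h => hY.mul_left ρ h e with h | h₁
    · refine Or.inl fun a => h _ _ ?_
      change ρ.r (e * (e * a)) (e * a)
      rw [hi]
    rcases hρ (hY.rees ρ e) fun a b h => Or.inl h with h | h₂
    · refine Or.inr fun a => h _ _ (Or.inr ⟨?_, ?_⟩)
      · rw [hi]
      · rw [hY.2]
    refine absurd ?_ hinf
    -- The two congruences intersect in ρ, so its quotient embeds in a product of two finite ones.
    refine Finite.of_injective (β := Quotient (mulKer ρ e).toSetoid ×
      Quotient (hY.rees ρ e).toSetoid) (Quotient.lift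
        (fun a => (Quotient.mk _ a, Quotient.mk _ a)) fun a b h => Prod.ext
          (Quotient.sound (hY.mul_left ρ h e)) (Quotient.sound (Or.inl h))) ?_
    rintro ⟨a⟩ ⟨b⟩ h
    have hk : (mulKer ρ e).r a b := Quotient.exact (congrArg Prod.fst h)
    have hr : (hY.rees ρ e).r a b := Quotient.exact (congrArg Prod.snd h)
    apply Quotient.sound
    rcases hr with hr | ⟨ha, hb⟩
    · exact hr
    · exact ρ.iseqv.trans (ρ.iseqv.symm ha) (ρ.iseqv.trans hk hb)
  apply hinf
  let P : Y → Prop := fun e => ∀ a, ρ.r (e * a) a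
  have hP : ∀ e f, ρ.r e f → P e → P f := fun e f h he a =>
    ρ.iseqv.trans (ρ.mul_right (ρ.iseqv.symm h) a) (he a)
  -- Any two identities agree modulo ρ, and so do any two zeros.
  refine Finite.of_injective (β := Prop) (Quotient.lift P fun a b h =>
    propext ⟨hP a b h, hP b a (ρ.iseqv.symm h)⟩) ?_
  rintro ⟨e⟩ ⟨f⟩ h
  have h : P e ↔ P f := iff_of_eq h
  apply Quotient.sound
  change ρ.r e f
  by_cases he : P e
  · have hf := h.1 he e
    rw [hY.1] at hf
    exact ρ.iseqv.trans (ρ.iseqv.symm hf) (he f)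
  · have h₁ := (cases_on e).resolve_left he f
    have h₂ := (cases_on f).resolve_left (fun hf => he (h.2 hf)) e
    rw [hY.1] at h₂
    exact ρ.iseqv.trans (ρ.iseqv.symm h₁) h₂

theorem finite_of_rightNoetherian (hY : SemilatticeSemigroup Y)
    (hN : RightNoetherianSemigroup Y) : Finite Y := by
  by_contra hinf
  let A := {ρ : RightCongruence Y // ¬ Finite (Quotient ρ.toSetoid)}
  let eqY : RightCongruence Y :=
    { r := Eq, iseqv := eq_equivalence, mul_right := fun h s => by rw [h] }
  have : Nonempty A := ⟨eqY, fun h => hinf <|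
    Finite.of_injective (Quotient.mk eqY.toSetoid) fun _ _ h => Quotient.exact h⟩
  let le : A → A → Prop := fun ρ σ => ∀ a b, ρ.1.r a b → σ.1.r a b
  -- A chain has a largest member, so its upper bound still has infinite index.
  obtain ⟨ρ, hρ⟩ := exists_maximal_of_nonempty_chains_bounded (r := le) (fun c hc hne => by
      have : Nonempty c := hne.to_subtype
      obtain ⟨m, hm⟩ := hN.exists_largest (fun i : c => i.1.1) fun i j => by
        by_cases hij : i = j
        · exact ⟨j, by rw [hij]; exact fun _ _ h => h, fun _ _ h => h⟩
        rcases hc i.2 j.2 (fun h => hij (Subtype.ext h)) with h | h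
        · exact ⟨j, h, fun _ _ h => h⟩
        · exact ⟨i, fun _ _ h => h, h⟩
      exact ⟨m.1, fun a ha => hm ⟨a, ha⟩⟩)
    fun h k a b hab => k a b (h a b hab)
  refine ρ.2 (hY.finite_quotient_of_maximal ρ.1 fun σ hσ => ?_)
  by_cases hf : Finite (Quotient σ.toSetoid)
  · exact Or.inr hf
  · exact Or.inl (hρ ⟨σ, hf⟩ hσ)

end SemilatticeSemigroup

/-! ### One-sided inverses in monoids -/

/-- The kernel of left multiplication by `x`. -/
def leftMulKer {M : Type*} [Semigroup M] (x : M) : RightCongruence M where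
  r a b := x * a = x * b
  iseqv := ⟨fun _ => rfl, fun h => h.symm, fun h k => h.trans k⟩
  mul_right h s := by rw [← mul_assoc, ← mul_assoc, h]

theorem RightNoetherianSemigroup.mul_eq_one_symm {M : Type*} [Monoid M]
    (hM : RightNoetherianSemigroup M) {x y : M} (h : x * y = 1) : y * x = 1 := by
  have mono : ∀ m n, m ≤ n → ∀ a b, (leftMulKer (x ^ m)).r a b → (leftMulKer (x ^ n)).r a b := by
    intro m n hmn a b hab
    change x ^ m * a = x ^ m * b at hab
    change x ^ n * a = x ^ n * b
    rw [← Nat.sub_add_cancel hmn, pow_add, mul_assoc, hab, mul_assoc]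
  obtain ⟨n, hn⟩ := hM.exists_largest (fun n : ℕ => leftMulKer (x ^ n)) fun i j =>
    ⟨max i j, mono _ _ (le_max_left i j), mono _ _ (le_max_right i j)⟩
  have hxy : x ^ n * y ^ n = 1 := pow_mul_pow_eq_one n h
  -- Left multiplication by xⁿ⁺¹ sends both yⁿ(yx) and yⁿ to x, so by stability xⁿ identifies them
  -- too.
  have key : x ^ n * (y ^ n * (y * x)) = x ^ n * (y ^ n * 1) := by
    refine hn (n + 1) _ _ ?_
    change x ^ (n + 1) * _ = x ^ (n + 1) * _
    rw [pow_succ', mul_assoc, mul_assoc, ← mul_assoc (x ^ n), ← mul_assoc (x ^ n), hxy, one_mul,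
      one_mul, ← mul_assoc, h, one_mul, mul_one]
  rwa [← mul_assoc, ← mul_assoc, hxy, one_mul, mul_one, hxy] at key

theorem mainTheorem10 :
    (∀ (S : Type*) [Semigroup S], RightNoetherianSemigroup S →
      ∀ T : Subsemigroup S, InverseSemigroup T → RightNoetherianSemigroup T) ∧
    (∀ (S : Type*) [Semigroup S], RightNoetherianSemigroup S →
      ∀ Y : Subsemigroup S, SemilatticeSemigroup Y → Finite Y) ∧
    (∀ (M : Type*) [Monoid M], RightNoetherianSemigroup M →
      ∀ x : M, ((∃ y : M, x * y = 1) ∨ (∃ y : M, y * x = 1)) → IsUnit x) := by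
  refine ⟨fun S _ hS T hT => hS.of_inverse_subsemigroup T hT, fun S _ hS Y hY =>
    hY.finite_of_rightNoetherian (hS.of_inverse_subsemigroup Y hY.inverseSemigroup),
    fun M _ hM x => ?_⟩
  rintro (⟨y, h⟩ | ⟨y, h⟩)
  · exact ⟨⟨x, y, h, hM.mul_eq_one_symm h⟩, rfl⟩
  · exact ⟨⟨x, y, hM.mul_eq_one_symm h, h⟩, rfl⟩
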